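/- **Setting.** A metric-measure language $L$ consists of constant symbols, function symbols and relation symbols; each function or relation symbol has an arity $\ge 1$ and a modulus $\Delta:(0,\infty)\to(0,\infty)$, and each relation symbol $R$ has a bound $b_R\ge 0$. A metric-measure $L$-structure is a nonempty metric space $(M,\rho)$ of diameter at most $1$ with a Borel measure $\mu$ such that $\mu(M)\le 1$, an element $c^M\in M$ for each constant symbol $c$, a map $F^M:M^n\to M$ for each $n$-ary function symbol $F$, and a map $R^M:M^n\to[-b_R,b_R]$ for each $n$-ary relation symbol $R$, where each $F^M$ and each $R^M$ is uniformly continuous with the modulus $\Delta$ of its symbol: if $d(x,y)<\Delta(\varepsilon)$, then the values at $x$ and $y$ are at distance at most $\varepsilon$ (for every $\varepsilon>0$; $M^n$ carries the maximum metric). All measures $\mu$ considered are assumed to be $\tau$-additive: $\mu(\bigcup_i U_i)=\sup_i\mu(U_i)$ for every upward directed family $(U_i)$ of open sets. Terms are built from variables, constant symbols and function symbols as usual. $L$-formulas are built from $1$, $\rho(s,t)$ and $R(t_1,\dots,t_n)$ (for terms $s,t,t_i$) by $r\varphi$ ($r\in\mathbb R$), $\varphi+\psi$, $\varphi\wedge\psi$,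 $\sup_y\varphi$ and $\int\varphi\,dy$. They are interpreted in $M$ as real-valued functions $\varphi^M$ of their free variables, with $\wedge$ the minimum, $(\sup_y\varphi)^M(\bar a)=\sup_{b\in M}\varphi^M(\bar a,b)$ and $(\int\varphi\,dy)^M(\bar a)=\int_M\varphi^M(\bar a,y)\,d\mu(y)$. A map $f:M\to N$ between $L$-structures is an elementary embedding if $\varphi^N(f(\bar a))=\varphi^M(\bar a)$ for every formula $\varphi(\bar x)$ and all $\bar a$ in $M$. Structures $M$ and $N$ are elementarily equivalent if $\sigma^M=\sigma^N$ for every sentence (formula without free variables) $\sigma$. **Proposition 4.9 (Elementary amalgamation and joint embedding).** Let $L$ be a metric-measure language. 1. Let $M_0,M_1,M_2$ be metric-measure $L$-structures (with $\tau$-additive measures) and let $f:M_0\to M_1$ and $g:M_0\to M_2$ be elementary embeddings. Then there are a metric-measure $L$-structure $N$ (with $\tau$-additive measure) and elementary embeddings $f':M_1\to N$ and $g':M_2\to N$ such that $f'\circ f=g'\circ g$. 2. If $M_1$ and $M_2$ are elementarily equivalent metric-measure $L$-structures (with $\tau$-additive measures), then there are a metric-measure $L$-structure $N$ (with $\tau$-additive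 measure) and elementary embeddings $M_1\to N$ and $M_2\to N$. -/

import Mathlib

open MeasureTheory

universe u v w

namespace ContIntLogic

/-- A metric-measure language: constant, function and relation symbols, the latter two with an
arity `≥ 1` and a modulus of uniform continuity `Δ : (0, ∞) → (0, ∞)` (only its values at positive
reals matter), and each relation symbol with a uniform bound. The symbol `ρ` for the metric and the
symbol for the measure are logical symbols, see `Formula.dist` and `Formula.int`. -/
structure MMLanguage where
  Const : Type u
  Func : Type u
  Rel : Type u
  funcArity : Func → ℕ
  funcArity_pos : ∀ F, 1 ≤ funcArity F
  relArity : Rel → ℕ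
  relArity_pos : ∀ R, 1 ≤ relArity R
  relBound : Rel → ℝ
  relBound_nonneg : ∀ R, 0 ≤ relBound R
  funcMod : Func → ℝ → ℝ
  funcMod_pos : ∀ F ε, 0 < ε → 0 < funcMod F ε
  relMod : Rel → ℝ → ℝ
  relMod_pos : ∀ R ε, 0 < ε → 0 < relMod R ε

/-- Terms whose variables are among `x₀, …, xₙ₋₁`. -/
inductive Term (L : MMLanguage.{u}) (n : ℕ) : Type u where
  | var (i : Fin n) : Term L n
  | const (c : L.Const) : Term L n
  | func (F : L.Func) (t : Fin (L.funcArity F) → Term L n) : Term L n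

/-- Formulas whose free variables are among `x₀, …, xₙ₋₁`. The quantifiers `sup` and `int` bind the
last variable `xₙ` of a formula in `x₀, …, xₙ`. -/
inductive Formula (L : MMLanguage.{u}) : ℕ → Type u where
  | one {n : ℕ} : Formula L n
  | dist {n : ℕ} (s t : Term L n) : Formula L n
  | rel {n : ℕ} (R : L.Rel) (t : Fin (L.relArity R) → Term L n) : Formula L n
  | smul {n : ℕ} (r : ℝ) (φ : Formula L n) : Formula L n
  | add {n : ℕ} (φ ψ : Formula L n) : Formula L n
  | min {n : ℕ} (φ ψ : Formula L n) : Formula L n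
  | sup {n : ℕ} (φ : Formula L (n + 1)) : Formula L n
  | int {n : ℕ} (φ : Formula L (n + 1)) : Formula L n

/-- A sentence is a formula without free variables. -/
abbrev Sentence (L : MMLanguage.{u}) : Type u := Formula L 0

/-- `f` is uniformly continuous with modulus `Δ`. -/
def UnifContWithModulus {X Y : Type*} [PseudoMetricSpace X] [PseudoMetricSpace Y]
    (Δ : ℝ → ℝ) (f : X → Y) : Prop :=
  ∀ ε : ℝ, 0 < ε → ∀ x y : X, dist x y < Δ ε → dist (f x) (f y) ≤ ε

/-- A metric-measure `L`-structure: a nonempty metric space of diameter at most `1`, with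
interpretations of the symbols that obey the bounds and moduli of `L` (finite powers `Fin k → M`
carry the maximum metric), and with a Borel measure of total mass at most `1`. -/
structure MMStructure (L : MMLanguage.{u}) where
  carrier : Type v
  [nonempty : Nonempty carrier]
  [metric : MetricSpace carrier]
  [measurableSpace : MeasurableSpace carrier]
  [borelSpace : BorelSpace carrier]
  dist_le_one : ∀ a b : carrier, dist a b ≤ 1
  μ : Measure carrier
  measure_univ_le_one : μ Set.univ ≤ 1
  const : L.Const → carrier
  func : (F : L.Func) → (Fin (L.funcArity F) → carrier) → carrier
  rel : (R : L.Rel) → (Fin (L.relArity R) → carrier) → ℝ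
  func_unifCont : ∀ F, UnifContWithModulus (L.funcMod F) (func F)
  rel_unifCont : ∀ R, UnifContWithModulus (L.relMod R) (rel R)
  abs_rel_le : ∀ R a, |rel R a| ≤ L.relBound R

attribute [instance] MMStructure.nonempty MMStructure.metric MMStructure.measurableSpace
  MMStructure.borelSpace

/-- The interpretation `t^M : Mⁿ → M` of a term. -/
def Term.eval {L : MMLanguage.{u}} (M : MMStructure.{u, v} L) {n : ℕ} (a : Fin n → M.carrier) :
    Term L n → M.carrier
  | .var i => a i
  | .const c => M.const c
  | .func F t => M.func F (fun i => (t i).eval M a)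

/-- The interpretation `φ^M : Mⁿ → ℝ` of a formula. Every `φ^M` is bounded and uniformly
continuous, so the suprema and integrals below are genuine ones. -/
noncomputable def Formula.eval {L : MMLanguage.{u}} (M : MMStructure.{u, v} L) :
    {n : ℕ} → Formula L n → (Fin n → M.carrier) → ℝ
  | _, .one, _ => 1
  | _, .dist s t, a => Dist.dist (s.eval M a) (t.eval M a)
  | _, .rel R t, a => M.rel R (fun i => (t i).eval M a)
  | _, .smul r φ, a => r * φ.eval M a
  | _, .add φ ψ, a => φ.eval M a + ψ.eval M a
  | _, .min φ ψ, a => φ.eval M a ⊓ ψ.eval M a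
  | _, .sup φ, a => ⨆ b : M.carrier, φ.eval M (Fin.snoc (α := fun _ => M.carrier) a b)
  | _, .int φ, a => ∫ b : M.carrier, φ.eval M (Fin.snoc (α := fun _ => M.carrier) a b) ∂M.μ

/-- `f : M → N` is an elementary embedding: it preserves the values of all formulas. -/
def IsElementaryEmbedding {L : MMLanguage.{u}} {M : MMStructure.{u, v} L}
    {N : MMStructure.{u, w} L} (f : M.carrier → N.carrier) : Prop :=
  ∀ (n : ℕ) (φ : Formula L n) (a : Fin n → M.carrier), φ.eval N (f ∘ a) = φ.eval M a

/-- `M` and `N` are elementarily equivalent: every sentence has the same value in both. -/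
def ElementarilyEquivalent {L : MMLanguage.{u}} (M : MMStructure.{u, v} L)
    (N : MMStructure.{u, w} L) : Prop :=
  ∀ σ : Sentence L, σ.eval M Fin.elim0 = σ.eval N Fin.elim0

/-- A Borel measure is `τ`-additive if `μ (⋃ U) = sup μ U` over every upward directed family of
open sets. -/
def TauAdditive {X : Type*} [TopologicalSpace X] [MeasurableSpace X] (μ : Measure X) : Prop :=
  ∀ S : Set (Set X), (∀ U ∈ S, IsOpen U) → DirectedOn (· ⊆ ·) S → μ (⋃₀ S) = ⨆ U ∈ S, μ U

end ContIntLogic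

namespace ContIntLogic

open Filter Topology

variable {L : MMLanguage.{u}}

namespace UnifContWithModulus

/-! Both statements are cases of one: if `p : A → M₁` and `q : A → M₂` give every formula the same
values, then `M₁` and `M₂` embed elementarily in a common `N` that identifies `p a` with `q a`.
Amalgamation takes `A = M₀`; joint embedding takes `A` empty, where only sentences matter.

`N` is a metric ultrapower of `M₁`, and its measure is simply the image of the measure of `M₁` on
the diagonal. Łoś's theorem (`Formula.tendsto_eval_ultrapower`) still holds: values of formulas are
uniformly bounded and equicontinuous, and a τ-additive finite measure lives, up to a small error, on
finitely many small balls, so pointwise limits along an ultrafilter pass through the integral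
(`TauAdditive.tendsto_integral`).

To embed `M₂`, finitely many conditions on its elements are packed into one formula built from terms
`-|φ - r|`. Suprema transfer its approximate solvability from `M₂` to `M₁` (`exists_approx`). The
approximate solutions, taken along an ultrafilter on finite sets of conditions and error bounds,
form the elements of `N` that represent `M₂`. -/

theorem uniformContinuous {X Y : Type*} [PseudoMetricSpace X] [PseudoMetricSpace Y]
    {Δ : ℝ → ℝ} {f : X → Y} (hf : UnifContWithModulus Δ f) (hΔ : ∀ ε, 0 < ε → 0 < Δ ε) :
    UniformContinuous f := by
  rw [Metric.uniformContinuous_iff]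
  intro ε hε
  refine ⟨Δ (ε / 2), hΔ _ (half_pos hε), fun x y h => ?_⟩
  have := hf (ε / 2) (half_pos hε) _ _ h
  linarith

end UnifContWithModulus

/-! ### Uniform continuity and boundedness of formulas -/

theorem dist_snoc_le {X : Type*} [PseudoMetricSpace X] {n : ℕ} (a a' : Fin n → X) (b : X) :
    dist (Fin.snoc (α := fun _ => X) a b) (Fin.snoc (α := fun _ => X) a' b) ≤ dist a a' := by
  refine (dist_pi_le_iff dist_nonneg).2 fun i => ?_
  induction i using Fin.lastCases with
  | last => simp
  | cast i => simpa using dist_le_pi_dist a a' i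

theorem continuous_snoc {X : Type*} [TopologicalSpace X] {n : ℕ} (a : Fin n → X) :
    Continuous fun b => Fin.snoc (α := fun _ => X) a b := by
  refine continuous_pi fun i => ?_
  induction i using Fin.lastCases with
  | last => simpa using continuous_id'
  | cast i => simpa using continuous_const

theorem comp_snoc {X Y : Type*} (f : X → Y) {n : ℕ} (a : Fin n → X) (b : X) :
    f ∘ Fin.snoc (α := fun _ => X) a b = Fin.snoc (α := fun _ => Y) (f ∘ a) (f b) :=
  Fin.comp_snoc f a b

namespace MMStructure

theorem isFiniteMeasure (M : MMStructure.{u, v} L) : IsFiniteMeasure M.μ :=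
  ⟨M.measure_univ_le_one.trans_lt ENNReal.one_lt_top⟩

theorem measureReal_univ_le_one (M : MMStructure.{u, v} L) : M.μ.real Set.univ ≤ 1 :=
  ENNReal.toReal_le_of_le_ofReal zero_le_one (by simpa using M.measure_univ_le_one)

end MMStructure

theorem Term.uniformContinuous_eval (M : MMStructure.{u, v} L) {n : ℕ} (t : Term L n) :
    UniformContinuous fun a => t.eval M a := by
  induction t with
  | var i => exact Pi.uniformContinuous_proj _ i
  | const c => exact uniformContinuous_const
  | func F t ih =>
    exact ((M.func_unifCont F).uniformContinuous (L.funcMod_pos F)).comp (uniformContinuous_pi.2 ih)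

namespace Formula

theorem exists_bound (M : MMStructure.{u, v} L) {n : ℕ} (φ : Formula L n) :
    ∃ C : ℝ, ∀ a, |φ.eval M a| ≤ C := by
  have := M.isFiniteMeasure
  induction φ with
  | one => exact ⟨1, fun a => by simp [eval]⟩
  | dist s t =>
    refine ⟨1, fun a => ?_⟩
    simpa [eval, abs_of_nonneg dist_nonneg] using M.dist_le_one _ _
  | rel R t => exact ⟨_, fun a => M.abs_rel_le R _⟩
  | smul r φ ih =>
    obtain ⟨C, hC⟩ := ih
    refine ⟨|r| * C, fun a => ?_⟩
    rw [eval, abs_mul]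
    exact mul_le_mul_of_nonneg_left (hC a) (abs_nonneg r)
  | add φ ψ ih₁ ih₂ =>
    obtain ⟨C, hC⟩ := ih₁
    obtain ⟨D, hD⟩ := ih₂
    exact ⟨C + D, fun a => (abs_add_le _ _).trans (add_le_add (hC a) (hD a))⟩
  | min φ ψ ih₁ ih₂ =>
    obtain ⟨C, hC⟩ := ih₁
    obtain ⟨D, hD⟩ := ih₂
    exact ⟨max C D, fun a => abs_min_le_max_abs_abs.trans (max_le_max (hC a) (hD a))⟩
  | sup φ ih =>
    obtain ⟨C, hC⟩ := ih
    refine ⟨C, fun a => abs_le.2 ⟨?_, ciSup_le fun b => (abs_le.1 (hC _)).2⟩⟩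
    obtain ⟨b⟩ := M.nonempty
    exact (abs_le.1 (hC (Fin.snoc (α := fun _ => M.carrier) a b))).1.trans
      (le_ciSup (f := fun b => φ.eval M (Fin.snoc (α := fun _ => M.carrier) a b))
        ⟨C, by rintro _ ⟨b, rfl⟩; exact (abs_le.1 (hC _)).2⟩ b)
  | int φ ih =>
    obtain ⟨C, hC⟩ := ih
    have hC0 : 0 ≤ C := (abs_nonneg _).trans (hC fun _ => Classical.choice M.nonempty)
    refine ⟨C, fun a => ?_⟩
    have h : ∀ b, ‖φ.eval M (Fin.snoc (α := fun _ => M.carrier) a b)‖ ≤ C := fun b => hC _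
    refine (norm_integral_le_of_norm_le_const (ae_of_all M.μ h)).trans ?_
    exact mul_le_of_le_one_right hC0 M.measureReal_univ_le_one

theorem bddAbove_range_snoc (M : MMStructure.{u, v} L) {n : ℕ} (φ : Formula L (n + 1))
    (a : Fin n → M.carrier) :
    BddAbove (Set.range fun b => φ.eval M (Fin.snoc (α := fun _ => M.carrier) a b)) := by
  obtain ⟨C, hC⟩ := φ.exists_bound M
  exact ⟨C, by rintro _ ⟨b, rfl⟩; exact (abs_le.1 (hC _)).2⟩

/-- Continuity is a hypothesis because the integral case of the induction proving continuity already
needs integrability. -/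
theorem integrable_snoc_of_continuous (M : MMStructure.{u, v} L) {n : ℕ} (φ : Formula L (n + 1))
    (hφ : Continuous (φ.eval M)) (a : Fin n → M.carrier) :
    Integrable (fun b => φ.eval M (Fin.snoc (α := fun _ => M.carrier) a b)) M.μ := by
  have := M.isFiniteMeasure
  obtain ⟨C, hC⟩ := φ.exists_bound M
  exact Integrable.of_bound (hφ.comp (continuous_snoc a)).aestronglyMeasurable C
    (ae_of_all _ fun b => hC _)

/-- A quantifier preserves uniform continuity: adjoining the same last coordinate does not increase
distances, and the total mass is at most 1. -/
theorem uniformContinuous_eval (M : MMStructure.{u, v} L) {n : ℕ} (φ : Formula L n) :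
    UniformContinuous (φ.eval M) := by
  have := M.isFiniteMeasure
  induction φ with
  | one => exact uniformContinuous_const
  | dist s t => exact (s.uniformContinuous_eval M).dist (t.uniformContinuous_eval M)
  | rel R t =>
    exact ((M.rel_unifCont R).uniformContinuous (L.relMod_pos R)).comp
      (uniformContinuous_pi.2 fun i => (t i).uniformContinuous_eval M)
  | smul r φ ih => exact ih.const_smul r
  | add φ ψ ih₁ ih₂ => exact ih₁.add ih₂
  | min φ ψ ih₁ ih₂ =>
    exact lipschitzWith_min.uniformContinuous.comp (ih₁.prodMk ih₂)
  | sup φ ih =>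
    rw [Metric.uniformContinuous_iff] at ih ⊢
    intro ε hε
    obtain ⟨δ, hδ, h⟩ := ih (ε / 2) (half_pos hε)
    have key : ∀ a a' : Fin _ → M.carrier, Dist.dist a a' < δ →
        φ.sup.eval M a ≤ φ.sup.eval M a' + ε / 2 := by
      intro a a' haa
      refine ciSup_le fun b => ?_
      have h1 := (abs_lt.1 (h ((dist_snoc_le a a' b).trans_lt haa))).2
      have h2 := le_ciSup (φ.bddAbove_range_snoc M a') b
      change _ ≤ φ.sup.eval M a' at h2
      linarith
    refine ⟨δ, hδ, fun a a' haa => ?_⟩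
    have h1 := key a a' haa
    have h2 := key a' a (by rwa [dist_comm])
    rw [Real.dist_eq, abs_lt]
    constructor <;> linarith
  | int φ ih =>
    have hint := φ.integrable_snoc_of_continuous M ih.continuous
    rw [Metric.uniformContinuous_iff] at ih ⊢
    intro ε hε
    obtain ⟨δ, hδ, h⟩ := ih (ε / 2) (half_pos hε)
    refine ⟨δ, hδ, fun a a' haa => ?_⟩
    rw [dist_eq_norm, eval, eval, ← integral_sub (hint a) (hint a')]
    refine (norm_integral_le_of_norm_le_const (C := ε / 2) (ae_of_all _ fun b => ?_)).trans_lt ?_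
    · exact (h ((dist_snoc_le a a' b).trans_lt haa)).le
    · exact (mul_le_of_le_one_right (half_pos hε).le M.measureReal_univ_le_one).trans_lt
        (half_lt_self hε)

theorem integrable_snoc (M : MMStructure.{u, v} L) {n : ℕ} (φ : Formula L (n + 1))
    (a : Fin n → M.carrier) :
    Integrable (fun b => φ.eval M (Fin.snoc (α := fun _ => M.carrier) a b)) M.μ :=
  φ.integrable_snoc_of_continuous M (φ.uniformContinuous_eval M).continuous a

end Formula

/-! ### Limits of integrals of equicontinuous families along a filter -/

/-- The finite unions of `δ`-balls form a directed open cover, so τ-additivity makes their measures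
approach the total mass. -/
theorem TauAdditive.exists_finset_measure_compl_lt {X : Type*} [PseudoMetricSpace X]
    [MeasurableSpace X] [BorelSpace X] {μ : Measure X} [IsFiniteMeasure μ] (hμ : TauAdditive μ)
    {δ ε : ℝ} (hδ : 0 < δ) (hε : 0 < ε) :
    ∃ s : Finset X, μ.real (⋃ a ∈ s, Metric.ball a δ)ᶜ < ε := by
  classical
  set V : Finset X → Set X := fun s => ⋃ a ∈ s, Metric.ball a δ with hV
  have hopen : ∀ s, IsOpen (V s) := fun s => isOpen_biUnion fun a _ => Metric.isOpen_ball
  have hmono : Monotone V := fun s t hst => Set.biUnion_subset_biUnion_left hst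
  have hdir : DirectedOn (· ⊆ ·) (Set.range V) :=
    directedOn_range.2 hmono.directed_le
  have huniv : ⋃₀ Set.range V = Set.univ := by
    refine Set.eq_univ_of_forall fun x => ⟨V {x}, ⟨_, rfl⟩, ?_⟩
    simpa [hV] using hδ
  have h := hμ (Set.range V) (by rintro _ ⟨s, rfl⟩; exact hopen s) hdir
  rw [huniv, iSup_range] at h
  rcases eq_or_ne (μ Set.univ) 0 with h0 | h0
  · exact ⟨∅, by simpa [Measure.real, h0] using hε⟩
  have hlt : μ Set.univ - ENNReal.ofReal ε < ⨆ s, μ (V s) := by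
    rw [← h]
    exact ENNReal.sub_lt_self (measure_ne_top _ _) h0 (by simpa using hε)
  obtain ⟨s, hs⟩ := lt_iSup_iff.1 hlt
  refine ⟨s, ?_⟩
  have h1 : μ Set.univ < μ (V s) + ENNReal.ofReal ε :=
    lt_of_not_ge fun hle => hs.not_ge (ENNReal.le_sub_of_add_le_right ENNReal.ofReal_ne_top hle)
  have h2 := ENNReal.toReal_lt_toReal (measure_ne_top _ _)
    (ENNReal.add_ne_top.2 ⟨measure_ne_top _ _, ENNReal.ofReal_ne_top⟩) |>.2 h1
  rw [ENNReal.toReal_add (measure_ne_top _ _) ENNReal.ofReal_ne_top, ENNReal.toReal_ofReal hε.le]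
    at h2
  rw [measureReal_compl (hopen s).measurableSet]
  simp only [Measure.real]
  linarith

/-- This replaces dominated convergence, which needs a countably generated filter. On finitely many
small balls, equicontinuity upgrades convergence at the centres to uniform convergence; the
remaining set has small measure and is handled by the bound `C`. -/
theorem TauAdditive.tendsto_integral {X ι : Type*} [PseudoMetricSpace X] [MeasurableSpace X]
    [BorelSpace X] {μ : Measure X} [IsFiniteMeasure μ] (hμ : TauAdditive μ) {l : Filter ι} [l.NeBot]
    {f : ι → X → ℝ} {g : X → ℝ} {C : ℝ} (hf : ∀ i, Integrable (f i) μ) (hg : Integrable g μ)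
    (hC : ∀ i x, |f i x| ≤ C) (hequi : UniformEquicontinuous f)
    (hlim : ∀ x, Tendsto (fun i => f i x) l (𝓝 (g x))) :
    Tendsto (fun i => ∫ x, f i x ∂μ) l (𝓝 (∫ x, g x ∂μ)) := by
  have hgC : ∀ x, |g x| ≤ C := fun x =>
    le_of_tendsto (hlim x).abs (Eventually.of_forall fun i => hC i x)
  rcases isEmpty_or_nonempty X with hX | ⟨⟨x₀⟩⟩
  · simp [Measure.eq_zero_of_isEmpty μ]
  have hC0 : 0 ≤ C := (abs_nonneg _).trans (hgC x₀)
  rw [Metric.tendsto_nhds]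
  intro ε hε
  set m := μ.real Set.univ with hm
  have hm0 : 0 ≤ m := measureReal_nonneg
  -- Chosen so that `3 * η * (m + 1) = ε / 2`: three errors of size `η` arise in passing through the
  -- centre of a ball, and `m + 1` avoids dividing by zero.
  set η := ε / (3 * (m + 1) * 2) with hη
  have hη0 : 0 < η := by positivity
  obtain ⟨δ, hδ, hfδ⟩ := Metric.uniformEquicontinuous_iff.1 hequi η hη0
  have hgδ : ∀ x y, dist x y < δ → |g x - g y| ≤ η := fun x y hxy =>
    le_of_tendsto ((hlim x).sub (hlim y)).abs (Eventually.of_forall fun i => (hfδ x y hxy i).le)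
  obtain ⟨s, hs⟩ := hμ.exists_finset_measure_compl_lt hδ
    (show 0 < ε / (2 * (2 * C + 1)) by positivity)
  set V := ⋃ a ∈ s, Metric.ball a δ with hV
  have hVm : MeasurableSet V := (isOpen_biUnion fun a _ => Metric.isOpen_ball).measurableSet
  have hev : ∀ᶠ i in l, ∀ a ∈ s, |f i a - g a| < η :=
    (Filter.eventually_all_finset s).2 fun a _ => Metric.tendsto_nhds.1 (hlim a) η hη0
  filter_upwards [hev] with i hi
  have hpt : ∀ x ∈ V, ‖f i x - g x‖ ≤ 3 * η := by
    intro x hx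
    obtain ⟨a, ha, hxa⟩ := Set.mem_iUnion₂.1 hx
    have h1 := abs_lt.1 (show |f i x - f i a| < η from hfδ x a hxa i)
    have h2 := abs_le.1 (hgδ x a hxa)
    have h3 := abs_lt.1 (hi a ha)
    rw [Real.norm_eq_abs, abs_le]
    constructor <;> linarith [h1.1, h1.2, h2.1, h2.2, h3.1, h3.2]
  have hpt' : ∀ x, ‖f i x - g x‖ ≤ 2 * C := by
    intro x
    have h1 := abs_le.1 (hC i x)
    have h2 := abs_le.1 (hgC x)
    rw [Real.norm_eq_abs, abs_le]
    constructor <;> linarith [h1.1, h1.2, h2.1, h2.2]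
  have hI : ‖∫ x in V, (f i x - g x) ∂μ‖ ≤ 3 * η * μ.real V :=
    norm_setIntegral_le_of_norm_le_const (measure_lt_top _ _) hpt
  have hI' : ‖∫ x in Vᶜ, (f i x - g x) ∂μ‖ ≤ 2 * C * μ.real Vᶜ :=
    norm_setIntegral_le_of_norm_le_const (measure_lt_top _ _) fun x _ => hpt' x
  rw [dist_eq_norm, ← integral_sub (hf i) hg, ← integral_add_compl (f := fun x => f i x - g x) hVm
    ((hf i).sub hg)]
  refine (norm_add_le _ _).trans_lt ?_
  have h1 : 3 * η * μ.real V ≤ ε / 2 := by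
    have : μ.real V ≤ m + 1 := (measureReal_mono (Set.subset_univ V)).trans (by linarith)
    calc 3 * η * μ.real V ≤ 3 * η * (m + 1) := by gcongr
      _ = ε / 2 := by rw [hη]; field_simp
  have h2 : 2 * C * μ.real Vᶜ < ε / 2 := by
    have : (2 * C + 1) * μ.real Vᶜ < ε / 2 := by
      have := mul_lt_mul_of_pos_left hs (show 0 < 2 * C + 1 by positivity)
      calc _ < _ := this
        _ = ε / 2 := by field_simp
    linarith [measureReal_nonneg (μ := μ) (s := Vᶜ)]
  linarith

theorem TauAdditive.map {X Y : Type*} [TopologicalSpace X] [MeasurableSpace X] [BorelSpace X]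
    [TopologicalSpace Y] [MeasurableSpace Y] [BorelSpace Y] {μ : Measure X} (hμ : TauAdditive μ)
    {f : X → Y} (hf : Continuous f) : TauAdditive (μ.map f) := by
  intro S hS hdir
  have h := hμ ((f ⁻¹' ·) '' S) (by rintro _ ⟨U, hU, rfl⟩; exact (hS U hU).preimage hf)
    (by
      rintro _ ⟨U, hU, rfl⟩ _ ⟨V, hV, rfl⟩
      obtain ⟨W, hW, h1, h2⟩ := hdir U hU V hV
      exact ⟨_, ⟨W, hW, rfl⟩, Set.preimage_mono h1, Set.preimage_mono h2⟩)
  rw [iSup_image, Set.sUnion_image, ← Set.preimage_iUnion₂, ← Set.sUnion_eq_biUnion] at h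
  rw [Measure.map_apply hf.measurable (isOpen_sUnion hS).measurableSet, h]
  exact biSup_congr fun U hU => (Measure.map_apply hf.measurable (hS U hU).measurableSet).symm

theorem integral_map_of_continuous {X Y : Type*} [TopologicalSpace X] [MeasurableSpace X]
    [BorelSpace X] [TopologicalSpace Y] [MeasurableSpace Y] [BorelSpace Y] {μ : Measure X}
    {f : X → Y} (hf : Continuous f) {g : Y → ℝ} (hg : Continuous g) :
    ∫ y, g y ∂μ.map f = ∫ x, g (f x) ∂μ :=
  integral_map hf.aemeasurable hg.stronglyMeasurable.aestronglyMeasurable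

/-! ### Ultrapowers -/

theorem tendsto_limUnder_of_abs_le {I : Type*} (U : Ultrafilter I) {f : I → ℝ} {C : ℝ}
    (hf : ∀ i, |f i| ≤ C) : Tendsto f U (𝓝 (limUnder (U : Filter I) f)) := by
  refine tendsto_nhds_limUnder ?_
  obtain ⟨l, -, hl⟩ := (isCompact_Icc (a := -C) (b := C)).ultrafilter_le_nhds (U.map f)
    (le_principal_iff.2 (Ultrafilter.mem_map.2 (Eventually.of_forall fun i => abs_le.1 (hf i))))
  exact ⟨l, hl⟩

/-- This makes interpretations in the ultrapower independent of the chosen representatives. -/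
theorem tendsto_dist_comp_zero {ι I X Y : Type*} [Fintype ι] [PseudoMetricSpace X]
    [PseudoMetricSpace Y] {l : Filter I} {f : (ι → X) → Y} (hf : UniformContinuous f)
    {x y : ι → I → X} (h : ∀ k, Tendsto (fun i => dist (x k i) (y k i)) l (𝓝 0)) :
    Tendsto (fun i => dist (f fun k => x k i) (f fun k => y k i)) l (𝓝 0) := by
  rw [Metric.tendsto_nhds]
  intro ε hε
  obtain ⟨δ, hδ, hfδ⟩ := Metric.uniformContinuous_iff.1 hf ε hε
  filter_upwards [eventually_all.2 fun k => (h k).eventually_lt_const hδ] with i hi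
  simpa using hfδ ((dist_pi_lt_iff hδ).2 hi)

/-- Families of elements of `M` indexed by `I`, with the pseudometric given by the limit along the
ultrafilter `U`. -/
def UltraFamily (M : MMStructure.{u, v} L) {I : Type w} (_U : Ultrafilter I) : Type (max v w) :=
  I → M.carrier

namespace UltraFamily

variable {M : MMStructure.{u, v} L} {I : Type w} {U : Ultrafilter I}

theorem tendsto_dist_limUnder (M : MMStructure.{u, v} L) (U : Ultrafilter I)
    (x y : I → M.carrier) :
    Tendsto (fun i => dist (x i) (y i)) U (𝓝 (limUnder (U : Filter I) fun i => dist (x i) (y i))) :=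
  tendsto_limUnder_of_abs_le U (C := 1) fun i => by
    simpa [abs_of_nonneg dist_nonneg] using M.dist_le_one _ _

noncomputable instance : PseudoMetricSpace (UltraFamily M U) where
  dist x y := limUnder (U : Filter I) fun i => dist (x i) (y i)
  dist_self x := by simpa using tendsto_const_nhds.limUnder_eq
  dist_comm x y := by simp only [dist_comm]
  dist_triangle x y z := le_of_tendsto_of_tendsto' (tendsto_dist_limUnder M U x z)
    ((tendsto_dist_limUnder M U x y).add (tendsto_dist_limUnder M U y z))
    fun i => dist_triangle _ _ _

noncomputable instance : MeasurableSpace (SeparationQuotient (UltraFamily M U)) := borel _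

instance : BorelSpace (SeparationQuotient (UltraFamily M U)) := ⟨rfl⟩

/-- The class of a family in the metric ultrapower. -/
noncomputable def toQuotient (U : Ultrafilter I) (x : I → M.carrier) : SeparationQuotient (UltraFamily M U) :=
  SeparationQuotient.mk (X := UltraFamily M U) x

/-- A chosen representative of an element of the metric ultrapower. -/
noncomputable def rep (a : SeparationQuotient (UltraFamily M U)) : I → M.carrier :=
  Quotient.out a

@[simp]
theorem toQuotient_rep (a : SeparationQuotient (UltraFamily M U)) : toQuotient U (rep a) = a :=
  Quotient.out_eq a

theorem tendsto_dist (x y : I → M.carrier) :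
    Tendsto (fun i => dist (x i) (y i)) U (𝓝 (dist (toQuotient U x) (toQuotient U y))) :=
  tendsto_dist_limUnder M U x y

theorem toQuotient_eq_iff {x y : I → M.carrier} :
    toQuotient U x = toQuotient U y ↔ Tendsto (fun i => dist (x i) (y i)) U (𝓝 0) := by
  rw [← dist_eq_zero]
  exact ⟨fun h => h ▸ tendsto_dist x y, fun h => tendsto_nhds_unique (tendsto_dist x y) h⟩

theorem tendsto_dist_rep (x : I → M.carrier) :
    Tendsto (fun i => dist (rep (toQuotient U x) i) (x i)) U (𝓝 0) :=
  toQuotient_eq_iff.1 (toQuotient_rep _)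

theorem eventually_dist_rep_lt {ι : Type*} [Fintype ι]
    {a b : ι → SeparationQuotient (UltraFamily M U)} {δ : ℝ} (h : dist a b < δ) :
    ∀ᶠ i in (U : Filter I), dist (fun k => rep (a k) i) (fun k => rep (b k) i) < δ := by
  have hδ : 0 < δ := dist_nonneg.trans_lt h
  have h' : ∀ k, ∀ᶠ i in (U : Filter I), dist (rep (a k) i) (rep (b k) i) < δ := fun k =>
    (tendsto_dist (U := U) (rep (a k)) (rep (b k))).eventually_lt_const
      (by simpa using (dist_pi_lt_iff hδ).1 h k)
  filter_upwards [eventually_all.2 h'] with i hi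
  exact (dist_pi_lt_iff hδ).2 hi

/-- The diagonal embedding. -/
noncomputable def diag (U : Ultrafilter I) (a : M.carrier) : SeparationQuotient (UltraFamily M U) :=
  toQuotient U fun _ => a

theorem isometry_diag : Isometry (diag (M := M) U) :=
  Isometry.of_dist_eq fun _ _ => tendsto_nhds_unique (tendsto_dist _ _) tendsto_const_nhds

theorem tendsto_rel (R : L.Rel) (x : Fin (L.relArity R) → I → M.carrier) :
    Tendsto (fun i => M.rel R fun k => x k i) U (𝓝 (limUnder (U : Filter I)
      fun i => M.rel R fun k => rep (toQuotient U (x k)) i)) := by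
  have h1 := tendsto_limUnder_of_abs_le U
    fun i => M.abs_rel_le R fun k => rep (toQuotient U (x k)) i
  have h2 := tendsto_dist_comp_zero ((M.rel_unifCont R).uniformContinuous (L.relMod_pos R))
    fun k => tendsto_dist_rep (U := U) (x k)
  exact h1.congr_dist h2

end UltraFamily

open UltraFamily

/-- The metric ultrapower of `M`, with the image under the diagonal embedding of the measure
of `M`. -/
noncomputable def ultrapower (M : MMStructure.{u, v} L) {I : Type w} (U : Ultrafilter I) :
    MMStructure.{u, max v w} L where
  carrier := SeparationQuotient (UltraFamily M U)
  nonempty := ⟨diag U (Classical.choice M.nonempty)⟩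
  dist_le_one a b := by
    have h := tendsto_dist (U := U) (rep a) (rep b)
    rw [toQuotient_rep, toQuotient_rep] at h
    exact le_of_tendsto h (Eventually.of_forall fun i => M.dist_le_one _ _)
  -- With this measure, integrals in the ultrapower only see constant families.
  μ := M.μ.map (diag U)
  measure_univ_le_one := by
    rw [Measure.map_apply isometry_diag.continuous.measurable MeasurableSet.univ]
    exact M.measure_univ_le_one
  const c := diag U (M.const c)
  func F a := toQuotient U fun i => M.func F fun k => rep (a k) i
  rel R a := limUnder (U : Filter I) fun i => M.rel R fun k => rep (a k) i
  func_unifCont F ε hε a b hab := le_of_tendsto (tendsto_dist _ _)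
    ((eventually_dist_rep_lt hab).mono fun i hi => M.func_unifCont F ε hε _ _ hi)
  rel_unifCont R ε hε a b hab := le_of_tendsto
    ((tendsto_limUnder_of_abs_le U fun i => M.abs_rel_le R fun k => rep (a k) i).dist
      (tendsto_limUnder_of_abs_le U fun i => M.abs_rel_le R fun k => rep (b k) i))
    ((eventually_dist_rep_lt hab).mono fun i hi => M.rel_unifCont R ε hε _ _ hi)
  abs_rel_le R a := le_of_tendsto
    (tendsto_limUnder_of_abs_le U fun i => M.abs_rel_le R fun k => rep (a k) i).abs
    (Eventually.of_forall fun i => M.abs_rel_le R _)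

/-! ### Łoś's theorem and the diagonal embedding. -/

section Los

variable {M : MMStructure.{u, v} L} {I : Type w} {U : Ultrafilter I}

theorem TauAdditive.ultrapower (hM : TauAdditive M.μ) (U : Ultrafilter I) :
    TauAdditive (ultrapower M U).μ :=
  hM.map (isometry_diag (U := U)).continuous

theorem Term.eval_ultrapower {n : ℕ} (t : Term L n) (x : Fin n → I → M.carrier) :
    t.eval (ultrapower M U) (fun k => toQuotient U (x k)) =
      toQuotient U fun i => t.eval M fun k => x k i := by
  induction t with
  | var i => rfl
  | const c => rfl
  | func F t ih =>
    simp only [Term.eval, ih]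
    exact toQuotient_eq_iff.2 (tendsto_dist_comp_zero
      ((M.func_unifCont F).uniformContinuous (L.funcMod_pos F)) fun k => tendsto_dist_rep _)

theorem snoc_toQuotient {n : ℕ} (x : Fin n → I → M.carrier) (y : I → M.carrier) :
    Fin.snoc (α := fun _ => (ultrapower M U).carrier) (fun k => toQuotient U (x k))
      (toQuotient U y) =
      fun k => toQuotient U (Fin.snoc (α := fun _ => I → M.carrier) x y k) :=
  (comp_snoc (toQuotient U) x y).symm

theorem snoc_family {n : ℕ} (x : Fin n → I → M.carrier) (y : I → M.carrier) (i : I) :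
    (fun k => Fin.snoc (α := fun _ => I → M.carrier) x y k i) =
      Fin.snoc (α := fun _ => M.carrier) (fun k => x k i) (y i) :=
  comp_snoc (fun z : I → M.carrier => z i) x y

/-- Łoś's theorem for ultrapowers of structures with a `τ`-additive measure. -/
theorem Formula.tendsto_eval_ultrapower (hM : TauAdditive M.μ) {n : ℕ} (φ : Formula L n)
    (x : Fin n → I → M.carrier) :
    Tendsto (fun i => φ.eval M fun k => x k i) U
      (𝓝 (φ.eval (ultrapower M U) fun k => toQuotient U (x k))) := by
  have := M.isFiniteMeasure
  induction φ with
  | one => exact tendsto_const_nhds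
  | dist s t =>
    simp only [eval, Term.eval_ultrapower]
    exact tendsto_dist _ _
  | rel R t =>
    simp only [eval, Term.eval_ultrapower]
    exact tendsto_rel R _
  | smul r φ ih => exact (ih x).const_mul r
  | add φ ψ ih₁ ih₂ => exact (ih₁ x).add (ih₂ x)
  | min φ ψ ih₁ ih₂ => exact (ih₁ x).min (ih₂ x)
  | sup φ ih =>
    have ih' : ∀ y : I → M.carrier,
        Tendsto (fun i => φ.eval M (Fin.snoc (α := fun _ => M.carrier) (fun k => x k i) (y i))) U
          (𝓝 (φ.eval (ultrapower M U) (Fin.snoc (α := fun _ => (ultrapower M U).carrier)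
            (fun k => toQuotient U (x k)) (toQuotient U y)))) := by
      intro y
      rw [snoc_toQuotient]
      simpa only [snoc_family] using ih (Fin.snoc (α := fun _ => I → M.carrier) x y)
    obtain ⟨C, hC⟩ := φ.sup.exists_bound M
    have hl := tendsto_limUnder_of_abs_le U fun i => hC fun k => x k i
    -- Compactness supplies a limit of the suprema; it remains to identify it with the supremum in
    -- the ultrapower.
    convert hl using 2
    refine le_antisymm (ciSup_le fun b => ?_) (le_of_forall_pos_sub_le fun ε hε => ?_)
    · rw [← toQuotient_rep b]
      exact le_of_tendsto_of_tendsto' (ih' (rep b)) hl fun i =>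
        le_ciSup (φ.bddAbove_range_snoc M fun k => x k i) _
    -- A family of `ε`-near maximisers, one for each index, is a single element of the ultrapower.
    · have hy : ∀ i, ∃ b, φ.sup.eval M (fun k => x k i) - ε <
          φ.eval M (Fin.snoc (α := fun _ => M.carrier) (fun k => x k i) b) := fun i =>
        exists_lt_of_lt_ciSup (sub_lt_self _ hε)
      choose y hy using hy
      exact (le_of_tendsto_of_tendsto' (hl.sub_const ε) (ih' y) fun i => (hy i).le).trans
        (le_ciSup (φ.bddAbove_range_snoc (ultrapower M U) _) _)
  | int φ ih =>
    have ih' : ∀ b : M.carrier,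
        Tendsto (fun i => φ.eval M (Fin.snoc (α := fun _ => M.carrier) (fun k => x k i) b)) U
          (𝓝 (φ.eval (ultrapower M U) (Fin.snoc (α := fun _ => (ultrapower M U).carrier)
            (fun k => toQuotient U (x k)) (diag U b)))) := by
      intro b
      rw [diag, snoc_toQuotient]
      simpa only [snoc_family] using ih (Fin.snoc (α := fun _ => I → M.carrier) x fun _ => b)
    have hcont : Continuous fun b : (ultrapower M U).carrier =>
        φ.eval (ultrapower M U) (Fin.snoc (α := fun _ => (ultrapower M U).carrier)
          (fun k => toQuotient U (x k)) b) :=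
      (φ.uniformContinuous_eval _).continuous.comp (continuous_snoc _)
    have hmap : φ.int.eval (ultrapower M U) (fun k => toQuotient U (x k)) =
        ∫ b, φ.eval (ultrapower M U) (Fin.snoc (α := fun _ => (ultrapower M U).carrier)
          (fun k => toQuotient U (x k)) (diag U b)) ∂M.μ :=
      integral_map_of_continuous (isometry_diag (U := U)).continuous hcont
    obtain ⟨C, hC⟩ := φ.exists_bound M
    obtain ⟨D, hD⟩ := φ.exists_bound (ultrapower M U)
    rw [hmap]
    refine hM.tendsto_integral (C := C) (fun i => φ.integrable_snoc M _) ?_ (fun i b => hC _) ?_ ih'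
    · exact Integrable.of_bound (C := D) (hcont.comp
        (isometry_diag (U := U)).continuous).aestronglyMeasurable (ae_of_all _ fun b => hD _)
    -- The functions differ only in their parameters, so the modulus of `φ` in `M` serves every
    -- index.
    · rw [Metric.uniformEquicontinuous_iff]
      intro ε hε
      obtain ⟨δ, hδ, h⟩ := Metric.uniformContinuous_iff.1 (φ.uniformContinuous_eval M) ε hε
      refine ⟨δ, hδ, fun a b hab i => h ((dist_pi_lt_iff hδ).2 fun k => ?_)⟩
      induction k using Fin.lastCases with
      | last => simpa using hab
      | cast k => simpa using hδ

theorem isElementaryEmbedding_diag (hM : TauAdditive M.μ) :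
    IsElementaryEmbedding (N := ultrapower M U) (diag (M := M) U) := fun _ φ a =>
  tendsto_nhds_unique (φ.tendsto_eval_ultrapower hM fun k _ => a k) tendsto_const_nhds

end Los

/-! ### Renaming of variables -/

/-- Substitution of variables for variables in a term. -/
def Term.rename {n m : ℕ} (σ : Fin n → Fin m) : Term L n → Term L m
  | .var i => .var (σ i)
  | .const c => .const c
  | .func F t => .func F fun i => (t i).rename σ

theorem Term.eval_rename (M : MMStructure.{u, v} L) {n m : ℕ} (σ : Fin n → Fin m) (t : Term L n)
    (a : Fin m → M.carrier) : (t.rename σ).eval M a = t.eval M (a ∘ σ) := by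
  induction t with
  | var i => rfl
  | const c => rfl
  | func F t ih => simp only [rename, eval, ih]

/-- The extension of a renaming under a quantifier. -/
def liftRenaming {n m : ℕ} (σ : Fin n → Fin m) : Fin (n + 1) → Fin (m + 1) :=
  Fin.snoc (α := fun _ => Fin (m + 1)) (Fin.castSucc ∘ σ) (Fin.last m)

theorem snoc_comp_liftRenaming {X : Type*} {n m : ℕ} (σ : Fin n → Fin m) (a : Fin m → X) (b : X) :
    Fin.snoc (α := fun _ => X) a b ∘ liftRenaming σ = Fin.snoc (α := fun _ => X) (a ∘ σ) b := by
  rw [liftRenaming, comp_snoc]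
  congr 1
  · funext i
    simp
  · simp

namespace Formula

/-- Substitution of variables for the free variables of a formula. -/
def rename : {n m : ℕ} → (Fin n → Fin m) → Formula L n → Formula L m
  | _, _, _, .one => .one
  | _, _, σ, .dist s t => .dist (s.rename σ) (t.rename σ)
  | _, _, σ, .rel R t => .rel R fun i => (t i).rename σ
  | _, _, σ, .smul r φ => .smul r (φ.rename σ)
  | _, _, σ, .add φ ψ => .add (φ.rename σ) (ψ.rename σ)
  | _, _, σ, .min φ ψ => .min (φ.rename σ) (ψ.rename σ)
  | _, _, σ, .sup φ => .sup (φ.rename (liftRenaming σ))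
  | _, _, σ, .int φ => .int (φ.rename (liftRenaming σ))

theorem eval_rename (M : MMStructure.{u, v} L) {n m : ℕ} (σ : Fin n → Fin m) (φ : Formula L n)
    (a : Fin m → M.carrier) : (φ.rename σ).eval M a = φ.eval M (a ∘ σ) := by
  induction φ generalizing m with
  | one => rfl
  | dist s t => simp only [rename, eval, Term.eval_rename]
  | rel R t => simp only [rename, eval, Term.eval_rename]
  | smul r φ ih => simp only [rename, eval, ih]
  | add φ ψ ih₁ ih₂ => simp only [rename, eval, ih₁, ih₂]
  | min φ ψ ih₁ ih₂ => simp only [rename, eval, ih₁, ih₂]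
  | sup φ ih => simp only [rename, eval, ih, snoc_comp_liftRenaming]
  | int φ ih => simp only [rename, eval, ih, snoc_comp_liftRenaming]

/-- The formula `-|φ - r|`. -/
def negAbsSub {n : ℕ} (φ : Formula L n) (r : ℝ) : Formula L n :=
  .min (.add φ (.smul (-r) .one)) (.smul (-1) (.add φ (.smul (-r) .one)))

theorem eval_negAbsSub (M : MMStructure.{u, v} L) {n : ℕ} (φ : Formula L n) (r : ℝ)
    (a : Fin n → M.carrier) : (φ.negAbsSub r).eval M a = -|φ.eval M a - r| := by
  simp only [negAbsSub, eval, mul_one, neg_mul, one_mul, ← sub_eq_add_neg]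
  rw [abs, ← min_neg_neg, neg_neg, min_comm]

end Formula

/-! ### Approximate realization of types -/

/-- `p` and `q` are a partial elementary correspondence between `M₁` and `M₂`. -/
def PartialElementary {A : Type w} (M₁ M₂ : MMStructure.{u, v} L) (p : A → M₁.carrier)
    (q : A → M₂.carrier) : Prop :=
  ∀ (n : ℕ) (φ : Formula L n) (a : Fin n → A), φ.eval M₁ (p ∘ a) = φ.eval M₂ (q ∘ a)

/-- A formula whose variables are assigned to elements of a set. -/
abbrev Instance (L : MMLanguage.{u}) (X : Type w) : Type (max u w) :=
  Σ n : ℕ, Formula L n × (Fin n → X)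

/-- The value in `M` of an instance, given the values of its parameters. -/
noncomputable def Instance.eval {X : Type w} (M : MMStructure.{u, v} L) (h : X → M.carrier)
    (c : Instance L X) : ℝ :=
  c.2.1.eval M (h ∘ c.2.2)

namespace PartialElementary

variable {A : Type w} {M₁ M₂ : MMStructure.{u, v} L} {p : A → M₁.carrier} {q : A → M₂.carrier}

/-- Bind the last variable by `sup`, use the induction hypothesis, then choose a near maximiser.
Suprema need not be attained, so each half of this costs `ε / 2`. -/
theorem exists_append_gt (hpq : PartialElementary M₁ M₂ p q) {m k : ℕ} (φ : Formula L (m + k))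
    (a : Fin m → A) (b : Fin k → M₂.carrier) {ε : ℝ} (hε : 0 < ε) :
    ∃ b' : Fin k → M₁.carrier,
      φ.eval M₂ (Fin.append (q ∘ a) b) - ε < φ.eval M₁ (Fin.append (p ∘ a) b') := by
  induction k generalizing ε with
  | zero =>
    refine ⟨Fin.elim0, ?_⟩
    have h := hpq m φ a
    rw [Subsingleton.elim b Fin.elim0, Fin.append_elim0, Fin.append_elim0]
    simpa [h] using hε
  | succ k ih =>
    obtain ⟨b', hb'⟩ := ih (.sup φ) (Fin.init b) (half_pos hε)
    obtain ⟨y, hy⟩ := exists_lt_of_lt_ciSup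
      (sub_lt_self (φ.sup.eval M₁ (Fin.append (p ∘ a) b')) (half_pos hε))
    refine ⟨Fin.snoc (α := fun _ => M₁.carrier) b' y, ?_⟩
    have h := le_ciSup (φ.bddAbove_range_snoc M₂ (Fin.append (q ∘ a) (Fin.init b))) (b (Fin.last k))
    rw [← Fin.append_snoc, Fin.snoc_init_self] at h
    rw [Fin.append_snoc]
    change _ ≤ φ.sup.eval M₂ _ at h
    linarith

/-- The formula is the minimum of `1` and all `-|c - r|`, with `r` the value of `c` in `M₂`. A value
above `-ε` therefore puts every instance within `ε` of its target. -/
theorem exists_instance_formula {N : ℕ} {X : Type*} (x : Fin N → X) (q' : X → M₂.carrier)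
    (s : Finset (Instance L X)) (hs : ∀ c ∈ s, Set.range c.2.2 ⊆ Set.range x) :
    ∃ φ : Formula L N, 0 ≤ φ.eval M₂ (q' ∘ x) ∧ ∀ h : X → M₁.carrier, ∀ c ∈ s,
      φ.eval M₁ (h ∘ x) ≤ -|c.eval M₁ h - c.eval M₂ q'| := by
  classical
  induction s using Finset.induction_on with
  | empty => exact ⟨.one, by simp [Formula.eval], by simp⟩
  | insert c s hc ih =>
    obtain ⟨φ, hφ, hφs⟩ := ih fun c hc => hs c (Finset.mem_insert_of_mem hc)
    have hx : ∀ i, ∃ j, x j = c.2.2 i := fun i => hs c (Finset.mem_insert_self c s) ⟨i, rfl⟩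
    choose σ hσ using hx
    have hσ' : x ∘ σ = c.2.2 := funext hσ
    refine ⟨.min ((c.2.1.rename σ).negAbsSub (c.eval M₂ q')) φ, ?_, fun h d hd => ?_⟩
    · refine le_min ?_ hφ
      simp [Formula.eval_negAbsSub, Formula.eval_rename, Function.comp_assoc, hσ', Instance.eval]
    · rcases Finset.mem_insert.1 hd with rfl | hd
      · refine (min_le_left _ _).trans ?_
        simp [Formula.eval_negAbsSub, Formula.eval_rename, Function.comp_assoc, hσ', Instance.eval]
      · exact (min_le_right _ _).trans (hφs h d hd)

/-- Finitely many instances mention finitely many elements of `A` and `M₂`. The former are fixed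
parameters, the latter the tuple to be imitated in `M₁`. -/
theorem exists_approx (hpq : PartialElementary M₁ M₂ p q)
    (s : Finset (Instance L (A ⊕ M₂.carrier))) {ε : ℝ} (hε : 0 < ε) :
    ∃ h : M₂.carrier → M₁.carrier,
      ∀ c ∈ s, |c.eval M₁ (Sum.elim p h) - c.eval M₂ (Sum.elim q id)| < ε := by
  classical
  set T : Finset (A ⊕ M₂.carrier) := s.biUnion fun c => Finset.univ.image c.2.2 with hT
  set a : Fin T.toLeft.card → A := fun i => T.toLeft.equivFin.symm i with ha
  set b : Fin T.toRight.card → M₂.carrier := fun i => T.toRight.equivFin.symm i with hb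
  have hbinj : Function.Injective b := Subtype.val_injective.comp (Equiv.injective _)
  set x : Fin (T.toLeft.card + T.toRight.card) → A ⊕ M₂.carrier :=
    Fin.append (Sum.inl ∘ a) (Sum.inr ∘ b) with hx
  have hxT : ∀ t ∈ T, t ∈ Set.range x := by
    rintro (t | t) ht
    · refine ⟨Fin.castAdd _ (T.toLeft.equivFin ⟨t, Finset.mem_toLeft.2 ht⟩), ?_⟩
      simp [hx, ha]
    · refine ⟨Fin.natAdd _ (T.toRight.equivFin ⟨t, Finset.mem_toRight.2 ht⟩), ?_⟩
      simp [hx, hb]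
  have hcomp : ∀ {Y : Type v} (f : A → Y) (g : M₂.carrier → Y),
      Sum.elim f g ∘ x = Fin.append (f ∘ a) (g ∘ b) := by
    intro Y f g
    funext i
    refine Fin.addCases (fun i => ?_) (fun i => ?_) i <;> simp [hx]
  obtain ⟨φ, hφ, hφs⟩ := exists_instance_formula (M₁ := M₁) x (Sum.elim q id) s (by
    rintro c hc _ ⟨i, rfl⟩
    exact hxT _ (Finset.mem_biUnion.2 ⟨c, hc, Finset.mem_image_of_mem _ (Finset.mem_univ i)⟩))
  obtain ⟨b', hb'⟩ := hpq.exists_append_gt φ a b hε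
  -- Elements of `M₂` that no instance mentions get an arbitrary value.
  refine ⟨Function.extend b b' fun _ => Classical.choice M₁.nonempty, fun c hc => ?_⟩
  have h := hφs (Sum.elim p (Function.extend b b' fun _ => Classical.choice M₁.nonempty)) c hc
  rw [hcomp, Function.extend_comp hbinj] at h
  rw [hcomp, Function.id_comp] at hφ
  linarith

theorem exists_amalgam (hpq : PartialElementary M₁ M₂ p q) (hM : TauAdditive M₁.μ) :
    ∃ N : MMStructure.{u, max u v w} L, TauAdditive N.μ ∧
      ∃ (f : M₁.carrier → N.carrier) (g : M₂.carrier → N.carrier),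
        IsElementaryEmbedding f ∧ IsElementaryEmbedding g ∧ f ∘ p = g ∘ q := by
  classical
  let I := Finset (Instance L (A ⊕ M₂.carrier)) × ℕ
  have happ : ∀ i : I, ∃ h : M₂.carrier → M₁.carrier, ∀ c ∈ i.1,
      |c.eval M₁ (Sum.elim p h) - c.eval M₂ (Sum.elim q id)| < 1 / ((i.2 : ℝ) + 1) :=
    fun i => hpq.exists_approx i.1 Nat.one_div_pos_of_nat
  choose h hh using happ
  -- Refining `atTop` makes every instance eventually listed and every tolerance eventually met.
  let U : Ultrafilter I := Ultrafilter.of atTop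
  have hU : (U : Filter I) ≤ atTop := Ultrafilter.of_le _
  have hlim : ∀ c : Instance L (A ⊕ M₂.carrier),
      Tendsto (fun i => c.eval M₁ (Sum.elim p (h i))) U (𝓝 (c.eval M₂ (Sum.elim q id))) := by
    intro c
    refine Tendsto.mono_left ?_ hU
    rw [Metric.tendsto_nhds]
    intro ε hε
    obtain ⟨n, hn⟩ := exists_nat_one_div_lt hε
    filter_upwards [eventually_ge_atTop (({c}, n) : I)] with i hi
    refine (hh i c (hi.1 (Finset.mem_singleton_self c))).trans_le (le_trans ?_ hn.le)
    exact Nat.one_div_le_one_div hi.2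
  refine ⟨ultrapower M₁ U, hM.ultrapower U, diag U, fun b => toQuotient U fun i => h i b,
    isElementaryEmbedding_diag hM, fun n φ b => ?_, funext fun a => ?_⟩
  · exact tendsto_nhds_unique (φ.tendsto_eval_ultrapower hM fun k i => h i (b k))
      (hlim ⟨n, φ, Sum.inr ∘ b⟩)
  -- The instance `ρ(a, q a)` has value 0 in `M₂`, so `h i (q a)` tends to `p a` along `U`.
  · refine toQuotient_eq_iff.2 ?_
    simpa [Instance.eval, Formula.eval, Term.eval] using
      hlim ⟨2, .dist (.var 0) (.var 1), ![Sum.inl a, Sum.inr (q a)]⟩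

end PartialElementary

end ContIntLogic

theorem proposition4p9 (L : ContIntLogic.MMLanguage.{u}) :
    (∀ (M₀ M₁ M₂ : ContIntLogic.MMStructure.{u, v} L),
      ContIntLogic.TauAdditive M₀.μ → ContIntLogic.TauAdditive M₁.μ →
      ContIntLogic.TauAdditive M₂.μ →
      ∀ (f : M₀.carrier → M₁.carrier) (g : M₀.carrier → M₂.carrier),
        ContIntLogic.IsElementaryEmbedding f → ContIntLogic.IsElementaryEmbedding g →
        ∃ N : ContIntLogic.MMStructure.{u, max u v} L, ContIntLogic.TauAdditive N.μ ∧
          ∃ (f' : M₁.carrier → N.carrier) (g' : M₂.carrier → N.carrier),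
            ContIntLogic.IsElementaryEmbedding f' ∧ ContIntLogic.IsElementaryEmbedding g' ∧
            f' ∘ f = g' ∘ g) ∧
    (∀ (M₁ M₂ : ContIntLogic.MMStructure.{u, v} L),
      ContIntLogic.TauAdditive M₁.μ → ContIntLogic.TauAdditive M₂.μ →
      ContIntLogic.ElementarilyEquivalent M₁ M₂ →
        ∃ N : ContIntLogic.MMStructure.{u, max u v} L, ContIntLogic.TauAdditive N.μ ∧
          ∃ (f' : M₁.carrier → N.carrier) (g' : M₂.carrier → N.carrier),
            ContIntLogic.IsElementaryEmbedding f' ∧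
            ContIntLogic.IsElementaryEmbedding g') := by

  refine ⟨fun M₀ M₁ M₂ _ h₁ _ f g hf hg => ?_, fun M₁ M₂ h₁ _ h => ?_⟩
  · exact ContIntLogic.PartialElementary.exists_amalgam
      (fun n φ a => (hf n φ a).trans (hg n φ a).symm) h₁
  -- With no parameters available, only formulas without free variables have instances.
  · have hpq : ContIntLogic.PartialElementary M₁ M₂ (PEmpty.elim.{_, v + 1} : _ → M₁.carrier)
        PEmpty.elim := by
      intro n φ a
      cases n with
      | zero =>
        rw [Subsingleton.elim (PEmpty.elim ∘ a) Fin.elim0, h φ]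
        exact congrArg _ (Subsingleton.elim _ _)
      | succ n => exact (a 0).elim
    obtain ⟨N, hN, f, g, hf, hg, -⟩ := hpq.exists_amalgam h₁
    exact ⟨N, hN, f, g, hf, hg⟩
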